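/- **Setting.** All manifolds are described in local coordinates: an $m$-dimensional manifold is represented by an open set $U\subseteq\mathbb R^m$. For a map $\psi$ with Jacobian $J(x)=\partial_x\psi(x)$ write $\dot J(x,\dot x)$ for the derivative of $J$ at $x$ in direction $\dot x$. For a real square matrix, $A\succ 0$ means $u^\top A u>0$ for all $u\neq 0$ (symmetry is not required). A *geometric dynamical system* (GDS) on $U\subseteq\mathbb R^m$ consists of symmetric positive semidefinite matrices $G(x,\dot x)$ (metric, $C^1$) and $B(x,\dot x)$ (damping, continuous), a $C^1$ potential $\Phi(x)$ that is bounded below, and a motion policy $\ddot x=a(x,\dot x)$ with $$M a+\xi_G=-\nabla\Phi-B\dot x,\qquad M=G+\Xi_G,\quad \Xi_G=\tfrac12\sum_i\dot x_i\,\partial_{\dot x}g_i,\quad \xi_G=[\partial_x g_i\,\dot x]_{i=1}^m\,\dot x-\tfrac12\nabla_x(\dot x^\top G\dot x),$$ where $g_i$ is the $i$-th column of $G$. An *RMP-tree\** is a finite rooted tree; every node carries an open coordinate domain, and the edge from a node with coordinate $x$ to its $i$-th child carries a $C^2$ map $\psi_i$ from the domain of the node into that of the child, with Jacobian $J_i$,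 and a real $C^1$ weight function $w_i(x)$ (an auxiliary state on which the weights may depend is held fixed). All leaves are GDSs. At a leaf put $f=Ma$, $L=\tfrac12\dot x^\top G\dot x-\Phi$ and $V=\tfrac12\dot x^\top G\dot x+\Phi$. At an inner node, with the quantities of the $i$-th child evaluated at its state $(\psi_i(x),J_i\dot x)$, put $$f=\sum_i\Big(w_iJ_i^\top(f_i-M_i\dot J_i\dot x)+L_i\nabla w_i-(\dot x^\top\nabla w_i)J_i^\top G_iJ_i\dot x\Big),\quad M=\sum_i w_iJ_i^\top M_iJ_i,\quad G=\sum_i w_iJ_i^\top G_iJ_i,$$ $$L=\sum_i w_iL_i,\quad V=\sum_i w_iV_i,\quad B=\sum_i w_iJ_i^\top B_iJ_i,\quad \Phi=\sum_i w_i\Phi_i .$$ Let $\mathtt r$ be the root, with coordinate $q$ in the open set $U\subseteq\mathbb R^d$. The global policy is $\ddot q=M_{\mathtt r}(q,\dot q)^\dagger f_{\mathtt r}(q,\dot q)$, where $\dagger$ is the Moore–Penrose inverse. **Theorem.** Suppose $M_{\mathtt r}(q,\dot q)\succ0$ for all $q\in U$ and $\dot q\in\mathbb R^d$. 1. Along every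 trajectory $q(t)\in U$ of the global policy, $\frac{d}{dt}V_{\mathtt r}(q,\dot q)=-\dot q^\top B_{\mathtt r}(q,\dot q)\,\dot q$; if all weight functions are nonnegative, this is $\le 0$. 2. If further $G_{\mathtt r}\succ0$ and $B_{\mathtt r}\succ0$ at all states, then every trajectory on $[0,\infty)$ whose state $(q(t),\dot q(t))$ remains in a compact subset of $U\times\mathbb R^d$ converges forwardly to $$S=\{(q,\dot q): q\in U,\ \nabla\Phi_{\mathtt r}(q)=0,\ \dot q=0\},$$ i.e. for every open set $W\supseteq S$ one has $(q(t),\dot q(t))\in W$ for all sufficiently large $t$. -/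

import Mathlib

open Matrix Set Filter Topology

/-- Coordinate vectors of an `m`-dimensional manifold. -/
abbrev Coord (m : ℕ) : Type := Fin m → ℝ

/-- The gradient `∇ f (x)`, as the column vector of partial derivatives. -/
noncomputable def grad {m : ℕ} (f : Coord m → ℝ) (x : Coord m) : Coord m :=
  fun k => fderiv ℝ f x (Pi.single k 1)

/-- The Jacobian matrix `J(x) = ∂ₓ ψ`. -/
noncomputable def jac {m n : ℕ} (ψ : Coord m → Coord n) (x : Coord m) :
    Matrix (Fin n) (Fin m) ℝ :=
  Matrix.of fun i k => fderiv ℝ ψ x (Pi.single k 1) i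

/-- The time derivative `J̇(x, ẋ)` of the Jacobian along a motion through `x` with velocity `v`. -/
noncomputable def jacDot {m n : ℕ} (ψ : Coord m → Coord n) (x v : Coord m) :
    Matrix (Fin n) (Fin m) ℝ :=
  Matrix.of fun i k => fderiv ℝ (fun y => jac ψ y i k) x v

/-- `Ξ_G(x, ẋ) = ½ ∑ᵢ ẋᵢ ∂_ẋ gᵢ(x, ẋ)`, with `gᵢ` the `i`-th column of `G`. -/
noncomputable def curvXi {m : ℕ} (G : Coord m → Coord m → Matrix (Fin m) (Fin m) ℝ)
    (x v : Coord m) : Matrix (Fin m) (Fin m) ℝ :=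
  Matrix.of fun j k =>
    (1 / 2 : ℝ) * ∑ i, v i * fderiv ℝ (fun u => G x u j i) v (Pi.single k 1)

/-- The matrix `[∂ₓ gᵢ(x, ẋ) ẋ]ᵢ`, with `gᵢ` the `i`-th column of `G`. -/
noncomputable def metricDot {m : ℕ} (G : Coord m → Coord m → Matrix (Fin m) (Fin m) ℝ)
    (x v : Coord m) : Matrix (Fin m) (Fin m) ℝ :=
  Matrix.of fun j i => fderiv ℝ (fun y => G y v j i) x v

/-- `ξ_G(x, ẋ) = [∂ₓ gᵢ(x, ẋ) ẋ]ᵢ ẋ - ½ ∇ₓ (ẋᵀ G(x, ẋ) ẋ)`. -/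
noncomputable def curvForce {m : ℕ} (G : Coord m → Coord m → Matrix (Fin m) (Fin m) ℝ)
    (x v : Coord m) : Coord m :=
  metricDot G x v *ᵥ v - (1 / 2 : ℝ) • grad (fun y => v ⬝ᵥ (G y v *ᵥ v)) x

/-- `A ≻ 0` for a square real matrix, in the sense `uᵀ A u > 0` for all `u ≠ 0`. Symmetry is not
demanded, since the inertia `G + Ξ_G` of a GDS need not be symmetric. -/
def IsPosDef {m : ℕ} (A : Matrix (Fin m) (Fin m) ℝ) : Prop :=
  ∀ u : Coord m, u ≠ 0 → 0 < u ⬝ᵥ (A *ᵥ u)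

/-- The four Penrose equations: `X` is the Moore-Penrose inverse of `A`. -/
structure IsMoorePenrose {m : ℕ} (A X : Matrix (Fin m) (Fin m) ℝ) : Prop where
  mul_mul_left : A * X * A = A
  mul_mul_right : X * A * X = X
  symm_left : (A * X)ᵀ = A * X
  symm_right : (X * A)ᵀ = X * A

/-- The Moore-Penrose inverse `A†` (it exists and is unique for every real matrix). -/
noncomputable def pinv {m : ℕ} (A : Matrix (Fin m) (Fin m) ℝ) : Matrix (Fin m) (Fin m) ℝ :=
  Classical.epsilon (IsMoorePenrose A)

/-- The data of a leaf: coordinate domain, metric, damping, potential, and motion policy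
`ẍ = a(x, ẋ)`. -/
structure Leaf (m : ℕ) where
  dom : Set (Coord m)
  G : Coord m → Coord m → Matrix (Fin m) (Fin m) ℝ
  B : Coord m → Coord m → Matrix (Fin m) (Fin m) ℝ
  Φ : Coord m → ℝ
  a : Coord m → Coord m → Coord m

namespace Leaf

/-- The inertia `M = G + Ξ_G`. -/
noncomputable def M {m : ℕ} (ℓ : Leaf m) (x v : Coord m) : Matrix (Fin m) (Fin m) ℝ :=
  ℓ.G x v + curvXi ℓ.G x v

/-- The leaf is a geometric dynamical system: `G` and `B` are symmetric positive semidefinite, `Φ`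
is bounded below, everything is smooth enough for the equations to make sense, and the policy
satisfies `M(x,ẋ) a + ξ_G(x,ẋ) = -∇Φ(x) - B(x,ẋ) ẋ`. -/
structure IsGDS {m : ℕ} (ℓ : Leaf m) : Prop where
  isOpen_dom : IsOpen ℓ.dom
  contDiffOn_G : ∀ i j,
    ContDiffOn ℝ 1 (fun p : Coord m × Coord m => ℓ.G p.1 p.2 i j) (ℓ.dom ×ˢ univ)
  posSemidef_G : ∀ x ∈ ℓ.dom, ∀ v, (ℓ.G x v).PosSemidef
  continuousOn_B : ∀ i j,
    ContinuousOn (fun p : Coord m × Coord m => ℓ.B p.1 p.2 i j) (ℓ.dom ×ˢ univ)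
  posSemidef_B : ∀ x ∈ ℓ.dom, ∀ v, (ℓ.B x v).PosSemidef
  contDiffOn_Φ : ContDiffOn ℝ 1 ℓ.Φ ℓ.dom
  bddBelow_Φ : BddBelow (ℓ.Φ '' ℓ.dom)
  policy : ∀ x ∈ ℓ.dom, ∀ v,
    ℓ.M x v *ᵥ ℓ.a x v + curvForce ℓ.G x v = -grad ℓ.Φ x - ℓ.B x v *ᵥ v

end Leaf

/-- A weighted RMP-tree whose root has an `m`-dimensional coordinate: either a leaf, or a root with
coordinate domain `dom` and `K` child subtrees, the edge to the `i`-th child carrying the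
transformation `ψ i` and the weight function `w i` of the parent configuration. -/
inductive RMPTree : ℕ → Type
  | leaf {m : ℕ} (ℓ : Leaf m) : RMPTree m
  | node {m : ℕ} (dom : Set (Coord m)) (K : ℕ) (dim : Fin K → ℕ)
      (ψ : ∀ i : Fin K, Coord m → Coord (dim i)) (w : Fin K → Coord m → ℝ)
      (child : ∀ i : Fin K, RMPTree (dim i)) : RMPTree m

namespace RMPTree

/-- The coordinate domain of the root. -/
def dom {m : ℕ} : RMPTree m → Set (Coord m)
  | .leaf ℓ => ℓ.dom
  | .node dom _ _ _ _ _ => dom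

/-- All leaves are GDSs, and all edge maps and weights are smooth on (open) coordinate domains. -/
def HasGDSLeaves : {m : ℕ} → RMPTree m → Prop
  | _, .leaf ℓ => ℓ.IsGDS
  | _, .node dom _ _ ψ w child =>
      IsOpen dom ∧ ∀ i, ContDiffOn ℝ 2 (ψ i) dom ∧ MapsTo (ψ i) dom (child i).dom ∧
        ContDiffOn ℝ 1 (w i) dom ∧ (child i).HasGDSLeaves

/-- All weight functions are nonnegative. -/
def WeightsNonneg : {m : ℕ} → RMPTree m → Prop
  | _, .leaf _ => True
  | _, .node dom _ _ _ w child => ∀ i, (∀ x ∈ dom, 0 ≤ w i x) ∧ (child i).WeightsNonneg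

/-! The quantities stored at the root, computed from the children by the modified pullback. Each
is a function of the root state `(x, v)`; the state of the `i`-th child is its pushforward
`(ψᵢ(x), Jᵢ(x) v)`. -/

/-- Inertia: `M = G + Ξ_G` at a leaf, `M = ∑ᵢ wᵢ Jᵢᵀ Mᵢ Jᵢ` otherwise. -/
noncomputable def M : {m : ℕ} → RMPTree m → Coord m → Coord m → Matrix (Fin m) (Fin m) ℝ
  | _, .leaf ℓ, x, v => ℓ.M x v
  | _, .node _ _ _ ψ w child, x, v =>
      ∑ i, w i x • ((jac (ψ i) x)ᵀ * (child i).M (ψ i x) (jac (ψ i) x *ᵥ v) * jac (ψ i) x)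

/-- Metric: `G = ∑ᵢ wᵢ Jᵢᵀ Gᵢ Jᵢ`. -/
noncomputable def G : {m : ℕ} → RMPTree m → Coord m → Coord m → Matrix (Fin m) (Fin m) ℝ
  | _, .leaf ℓ, x, v => ℓ.G x v
  | _, .node _ _ _ ψ w child, x, v =>
      ∑ i, w i x • ((jac (ψ i) x)ᵀ * (child i).G (ψ i x) (jac (ψ i) x *ᵥ v) * jac (ψ i) x)

/-- The scalar `L`: `½ ẋᵀ G ẋ - Φ` at a leaf, `L = ∑ᵢ wᵢ Lᵢ` otherwise. -/
noncomputable def L : {m : ℕ} → RMPTree m → Coord m → Coord m → ℝ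
  | _, .leaf ℓ, x, v => (1 / 2 : ℝ) * (v ⬝ᵥ (ℓ.G x v *ᵥ v)) - ℓ.Φ x
  | _, .node _ _ _ ψ w child, x, v =>
      ∑ i, w i x * (child i).L (ψ i x) (jac (ψ i) x *ᵥ v)

/-- Force: `f = M a` at a leaf, `f = ∑ᵢ (wᵢ Jᵢᵀ (fᵢ - Mᵢ J̇ᵢ ẋ) + hᵢ)` otherwise, with
`hᵢ = Lᵢ ∇wᵢ - (ẋᵀ ∇wᵢ) Jᵢᵀ Gᵢ Jᵢ ẋ`. -/
noncomputable def f : {m : ℕ} → RMPTree m → Coord m → Coord m → Coord m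
  | _, .leaf ℓ, x, v => ℓ.M x v *ᵥ ℓ.a x v
  | _, .node _ _ _ ψ w child, x, v =>
      ∑ i, (w i x • ((jac (ψ i) x)ᵀ *ᵥ
              ((child i).f (ψ i x) (jac (ψ i) x *ᵥ v)
                - (child i).M (ψ i x) (jac (ψ i) x *ᵥ v) *ᵥ (jacDot (ψ i) x v *ᵥ v)))
            + ((child i).L (ψ i x) (jac (ψ i) x *ᵥ v) • grad (w i) x
                - (v ⬝ᵥ grad (w i) x) •
                  (((jac (ψ i) x)ᵀ * (child i).G (ψ i x) (jac (ψ i) x *ᵥ v) * jac (ψ i) x) *ᵥ v)))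

/-- Lyapunov function: `½ ẋᵀ G ẋ + Φ` at a leaf, `V = ∑ᵢ wᵢ Vᵢ` otherwise. -/
noncomputable def V : {m : ℕ} → RMPTree m → Coord m → Coord m → ℝ
  | _, .leaf ℓ, x, v => (1 / 2 : ℝ) * (v ⬝ᵥ (ℓ.G x v *ᵥ v)) + ℓ.Φ x
  | _, .node _ _ _ ψ w child, x, v =>
      ∑ i, w i x * (child i).V (ψ i x) (jac (ψ i) x *ᵥ v)

/-- Damping: `B = ∑ᵢ wᵢ Jᵢᵀ Bᵢ Jᵢ`. -/
noncomputable def B : {m : ℕ} → RMPTree m → Coord m → Coord m → Matrix (Fin m) (Fin m) ℝ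
  | _, .leaf ℓ, x, v => ℓ.B x v
  | _, .node _ _ _ ψ w child, x, v =>
      ∑ i, w i x • ((jac (ψ i) x)ᵀ * (child i).B (ψ i x) (jac (ψ i) x *ᵥ v) * jac (ψ i) x)

/-- Potential: `Φ = ∑ᵢ wᵢ Φᵢ`. -/
noncomputable def Φ : {m : ℕ} → RMPTree m → Coord m → ℝ
  | _, .leaf ℓ, x => ℓ.Φ x
  | _, .node _ _ _ ψ w child, x => ∑ i, w i x * (child i).Φ (ψ i x)

/-- The global motion policy, obtained by resolving the root: `a = M† f`. -/
noncomputable def policy {m : ℕ} (T : RMPTree m) (x v : Coord m) : Coord m :=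
  pinv (T.M x v) *ᵥ T.f x v

/-- `q`, with velocity `qd`, is a trajectory over the times in `I` of `q̈ = policy(q, q̇)`. -/
structure IsTrajectoryOn {m : ℕ} (T : RMPTree m) (q qd : ℝ → Coord m) (I : Set ℝ) : Prop where
  mem_dom : ∀ t ∈ I, q t ∈ T.dom
  hasDeriv_q : ∀ t ∈ I, HasDerivWithinAt q (qd t) I t
  hasDeriv_qd : ∀ t ∈ I, HasDerivWithinAt qd (T.policy (q t) (qd t)) I t

end RMPTree

/-!
Along any curve, whether or not it follows the policy, `d/dt V = ẋᵀ(M ẍ - f) - ẋᵀ B ẋ`. At a leaf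
this is the defining equation of a GDS. It passes through the pullback because the extra force
`Lᵢ ∇wᵢ - (ẋᵀ∇wᵢ) Jᵢᵀ Gᵢ Jᵢ ẋ` has power `-Vᵢ ẇᵢ`, cancelling the change of `V` caused by the
varying weights. Under the policy `M ẍ = f`, so `V` decreases at the rate `ẋᵀ B ẋ`.

On a trajectory in a compact set, `V` converges and its derivative is uniformly continuous, so
Barbalat's lemma gives `ẋᵀ B ẋ → 0`, hence `ẋ → 0`. Barbalat's lemma once more, applied to `ẋ`,
gives `ẍ → 0`. A limit state is thus at rest without acceleration, and there
`0 = M ẍ = f(x, 0) = -∇Φ(x)`.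
-/

section MatrixCalculus

variable {m n : Type*} [Fintype n] {I : Set ℝ} {t : ℝ}

theorem hasDerivWithinAt_dotProduct {u v : ℝ → n → ℝ} {u' v' : n → ℝ}
    (hu : HasDerivWithinAt u u' I t) (hv : HasDerivWithinAt v v' I t) :
    HasDerivWithinAt (fun s => u s ⬝ᵥ v s) (u' ⬝ᵥ v t + u t ⬝ᵥ v') I t := by
  simp only [dotProduct, ← Finset.sum_add_distrib]
  exact .fun_sum fun i _ => (hasDerivWithinAt_pi.1 hu i).fun_mul (hasDerivWithinAt_pi.1 hv i)

theorem hasDerivWithinAt_mulVec [Finite m] {A : ℝ → Matrix m n ℝ} {A' : Matrix m n ℝ}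
    {v : ℝ → n → ℝ} {v' : n → ℝ}
    (hA : ∀ i j, HasDerivWithinAt (fun s => A s i j) (A' i j) I t)
    (hv : HasDerivWithinAt v v' I t) :
    HasDerivWithinAt (fun s => A s *ᵥ v s) (A' *ᵥ v t + A t *ᵥ v') I t :=
  have := Fintype.ofFinite m
  hasDerivWithinAt_pi.2 fun i =>
    hasDerivWithinAt_dotProduct (hasDerivWithinAt_pi.2 fun j => hA i j) hv

theorem hasDerivWithinAt_half_dotProduct_mulVec {A : ℝ → Matrix n n ℝ} {A' : Matrix n n ℝ}
    {v : ℝ → n → ℝ} {v' : n → ℝ}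
    (hA : ∀ i j, HasDerivWithinAt (fun s => A s i j) (A' i j) I t)
    (hv : HasDerivWithinAt v v' I t) (hsymm : (A t).IsSymm) :
    HasDerivWithinAt (fun s => (1 / 2 : ℝ) * (v s ⬝ᵥ (A s *ᵥ v s)))
      (v t ⬝ᵥ (A t *ᵥ v') + (1 / 2 : ℝ) * (v t ⬝ᵥ (A' *ᵥ v t))) I t := by
  have hswap : v' ⬝ᵥ (A t *ᵥ v t) = v t ⬝ᵥ (A t *ᵥ v') := by
    rw [← dotProduct_transpose_mulVec, hsymm.eq]
  refine ((hasDerivWithinAt_dotProduct hv (hasDerivWithinAt_mulVec hA hv)).const_mul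
    (1 / 2 : ℝ)).congr_deriv ?_
  rw [dotProduct_add, hswap]
  ring

end MatrixCalculus

section MatrixContinuity

variable {X l m n R : Type*} [TopologicalSpace X] [TopologicalSpace R]
  [NonUnitalNonAssocSemiring R] [ContinuousAdd R] [ContinuousMul R] {s : Set X}

@[fun_prop]
theorem continuousOn_matrix_mul [Fintype m] {A : X → Matrix l m R} {B : X → Matrix m n R}
    (hA : ContinuousOn A s) (hB : ContinuousOn B s) : ContinuousOn (fun p => A p * B p) s :=
  (continuous_fst.matrix_mul continuous_snd).comp_continuousOn (hA.prodMk hB)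

@[fun_prop]
theorem continuousOn_mulVec [Fintype n] {A : X → Matrix m n R} {v : X → n → R}
    (hA : ContinuousOn A s) (hv : ContinuousOn v s) : ContinuousOn (fun p => A p *ᵥ v p) s :=
  (continuous_fst.matrix_mulVec continuous_snd).comp_continuousOn (hA.prodMk hv)

@[fun_prop]
theorem continuousOn_dotProduct [Fintype n] {u v : X → n → R}
    (hu : ContinuousOn u s) (hv : ContinuousOn v s) : ContinuousOn (fun p => u p ⬝ᵥ v p) s :=
  (continuous_fst.dotProduct continuous_snd).comp_continuousOn (hu.prodMk hv)

end MatrixContinuity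

theorem continuousOn_matrix {X m n R : Type*} [TopologicalSpace X] [TopologicalSpace R]
    {A : X → Matrix m n R} {s : Set X} (h : ∀ i j, ContinuousOn (fun p => A p i j) s) :
    ContinuousOn A s :=
  continuousOn_pi.2 fun i => continuousOn_pi.2 fun j => h i j

theorem continuousOn_fderiv_partial {E F H : Type*} [NormedAddCommGroup E] [NormedSpace ℝ E]
    [NormedAddCommGroup F] [NormedSpace ℝ F] [NormedAddCommGroup H] [NormedSpace ℝ H]
    {s : Set E} {g : E → F → H} {y : E → F}
    (hg : ∀ p ∈ s, ContDiffAt ℝ 1 (Function.uncurry g) (p, y p)) (hy : ContDiff ℝ 1 y) :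
    ContinuousOn (fun p => fderiv ℝ (g p) (y p)) s :=
  fun p hp =>
  have := (hg p hp).fderiv (m := 0) (hy.contDiffAt.of_le zero_le_one) (by simp)
  this.continuousAt.continuousWithinAt

section Gradient

variable {m n : ℕ}

theorem sum_smul_map_single {ι R M : Type*} [Fintype ι] [DecidableEq ι] [Semiring R]
    [AddCommMonoid M] [Module R M] (A : (ι → R) →ₗ[R] M) (v : ι → R) :
    ∑ k, v k • A (Pi.single k 1) = A v := by
  simp only [← map_smul, ← map_sum, ← Pi.single_smul, smul_eq_mul, mul_one, Finset.univ_sum_single]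

theorem dotProduct_grad (φ : Coord m → ℝ) (x v : Coord m) :
    v ⬝ᵥ grad φ x = fderiv ℝ φ x v :=
  sum_smul_map_single (fderiv ℝ φ x).toLinearMap v

theorem jac_mulVec (ψ : Coord m → Coord n) (x v : Coord m) : jac ψ x *ᵥ v = fderiv ℝ ψ x v :=
  LinearMap.toMatrix'_mulVec (fderiv ℝ ψ x).toLinearMap v

theorem grad_sum_mul_comp {ι : Type*} [Fintype ι] {dim : ι → ℕ} {w : ι → Coord m → ℝ}
    {ψ : ∀ i, Coord m → Coord (dim i)} {φ : ∀ i, Coord (dim i) → ℝ} {x : Coord m}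
    (hw : ∀ i, DifferentiableAt ℝ (w i) x) (hψ : ∀ i, DifferentiableAt ℝ (ψ i) x)
    (hφ : ∀ i, DifferentiableAt ℝ (φ i) (ψ i x)) :
    grad (fun y => ∑ i, w i y * φ i (ψ i y)) x
      = ∑ i, (w i x • ((jac (ψ i) x)ᵀ *ᵥ grad (φ i) (ψ i x)) + φ i (ψ i x) • grad (w i) x) := by
  refine dotProduct_eq _ _ fun v => ?_
  rw [dotProduct_comm, dotProduct_comm _ v]
  have hφψ : ∀ i, DifferentiableAt ℝ (fun y => φ i (ψ i y)) x := fun i => (hφ i).comp x (hψ i)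
  have hchain : ∀ i, fderiv ℝ (fun y => φ i (ψ i y)) x v
      = v ⬝ᵥ ((jac (ψ i) x)ᵀ *ᵥ grad (φ i) (ψ i x)) := fun i => by
    rw [Matrix.dotProduct_mulVec, vecMul_transpose, dotProduct_grad, jac_mulVec,
      ← ContinuousLinearMap.comp_apply, ← fderiv_comp x (hφ i) (hψ i)]
    rfl
  rw [dotProduct_grad, fderiv_fun_sum fun i _ => (hw i).fun_mul (hφψ i), dotProduct_sum]
  simp [fderiv_fun_mul (hw _) (hφψ _), hchain, dotProduct_grad]

end Gradient

section Curves

variable {m n : ℕ} {I : Set ℝ} {t : ℝ} {x v : ℝ → Coord m} {a : Coord m}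

theorem hasDerivWithinAt_comp_grad {φ : Coord m → ℝ} (hφ : DifferentiableAt ℝ φ (x t))
    (hx : HasDerivWithinAt x a I t) :
    HasDerivWithinAt (fun s => φ (x s)) (a ⬝ᵥ grad φ (x t)) I t := by
  rw [dotProduct_grad]
  exact hφ.hasFDerivAt.comp_hasDerivWithinAt t hx

theorem hasDerivWithinAt_comp_jac {ψ : Coord m → Coord n} (hψ : DifferentiableAt ℝ ψ (x t))
    (hx : HasDerivWithinAt x a I t) :
    HasDerivWithinAt (fun s => ψ (x s)) (jac ψ (x t) *ᵥ a) I t := by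
  rw [jac_mulVec]
  exact hψ.hasFDerivAt.comp_hasDerivWithinAt t hx

theorem hasDerivWithinAt_jac_mulVec {ψ : Coord m → Coord n}
    (hψ : ∀ i k, DifferentiableAt ℝ (fun y => jac ψ y i k) (x t))
    (hx : HasDerivWithinAt x (v t) I t) (hv : HasDerivWithinAt v a I t) :
    HasDerivWithinAt (fun s => jac ψ (x s) *ᵥ v s)
      (jacDot ψ (x t) (v t) *ᵥ v t + jac ψ (x t) *ᵥ a) I t :=
  hasDerivWithinAt_mulVec (fun i k => (hψ i k).hasFDerivAt.comp_hasDerivWithinAt t hx) hv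

end Curves

section Metric

variable {m : ℕ} {G : Coord m → Coord m → Matrix (Fin m) (Fin m) ℝ}

/-- The derivative of the metric `G(x, ẋ)` in its velocity argument, in the direction `a`; the
counterpart of `metricDot`. -/
noncomputable def metricVelDot (G : Coord m → Coord m → Matrix (Fin m) (Fin m) ℝ)
    (x v a : Coord m) : Matrix (Fin m) (Fin m) ℝ :=
  Matrix.of fun j i => fderiv ℝ (fun u => G x u j i) v a

theorem curvXi_mulVec (G : Coord m → Coord m → Matrix (Fin m) (Fin m) ℝ) (x v a : Coord m) :
    curvXi G x v *ᵥ a = (1 / 2 : ℝ) • (metricVelDot G x v a *ᵥ v) := by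
  ext j
  have hpartial : ∀ i, ∑ k, a k * fderiv ℝ (fun u => G x u j i) v (Pi.single k 1)
      = fderiv ℝ (fun u => G x u j i) v a := fun i =>
    sum_smul_map_single (fderiv ℝ (fun u => G x u j i) v).toLinearMap a
  simp only [curvXi, metricVelDot, mulVec, dotProduct, of_apply, Pi.smul_apply, smul_eq_mul,
    ← hpartial, Finset.mul_sum, Finset.sum_mul]
  rw [Finset.sum_comm]
  exact Finset.sum_congr rfl fun i _ => Finset.sum_congr rfl fun k _ => by ring

theorem curvForce_zero (G : Coord m → Coord m → Matrix (Fin m) (Fin m) ℝ) (x : Coord m) :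
    curvForce G x 0 = 0 := by
  ext k
  simp [curvForce, grad]

theorem dotProduct_curvForce {x v : Coord m}
    (hG : ∀ i j, DifferentiableAt ℝ (fun y => G y v i j) x) :
    v ⬝ᵥ curvForce G x v = (1 / 2 : ℝ) * (v ⬝ᵥ (metricDot G x v *ᵥ v)) := by
  have hquad : fderiv ℝ (fun y => v ⬝ᵥ (G y v *ᵥ v)) x v = v ⬝ᵥ (metricDot G x v *ᵥ v) := by
    have hsum : HasFDerivAt (fun y => ∑ i, v i * ∑ j, G y v i j * v j) _ x :=
      .fun_sum fun i _ => (HasFDerivAt.fun_sum fun j _ =>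
        (hG i j).hasFDerivAt.mul_const (v j)).const_mul (v i)
    refine (DFunLike.congr_fun hsum.fderiv v).trans ?_
    simp [metricDot, dotProduct, mulVec, mul_comm]
  rw [curvForce, dotProduct_sub, dotProduct_smul, dotProduct_grad, hquad, smul_eq_mul]
  ring

variable {I : Set ℝ} {t : ℝ} {x v : ℝ → Coord m} {v' : Coord m}

theorem hasDerivWithinAt_metric
    (hG : ∀ i j, DifferentiableAt ℝ (fun p : Coord m × Coord m => G p.1 p.2 i j) (x t, v t))
    (hx : HasDerivWithinAt x (v t) I t) (hv : HasDerivWithinAt v v' I t) (i j : Fin m) :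
    HasDerivWithinAt (fun s => G (x s) (v s) i j)
      ((metricDot G (x t) (v t) + metricVelDot G (x t) (v t) v') i j) I t := by
  set g := fderiv ℝ (fun p : Coord m × Coord m => G p.1 p.2 i j) (x t, v t) with hg
  have hposition : HasFDerivAt (fun y => G y (v t) i j) (g ∘L .inl ℝ _ _) (x t) :=
    (hG i j).hasFDerivAt.comp (f := fun y => (y, v t)) (x t) (hasFDerivAt_prodMk_left _ _)
  have hvelocity : HasFDerivAt (fun u => G (x t) u i j) (g ∘L .inr ℝ _ _) (v t) :=
    (hG i j).hasFDerivAt.comp (v t) (hasFDerivAt_prodMk_right _ _)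
  have hcurve := (hG i j).hasFDerivAt.comp_hasDerivWithinAt t (hx.prodMk hv)
  refine hcurve.congr_deriv ?_
  rw [← hg, ← g.comp_inl_add_comp_inr, Matrix.add_apply, metricDot, metricVelDot, of_apply,
    of_apply, hposition.fderiv, hvelocity.fderiv]

theorem hasDerivWithinAt_kinetic
    (hG : ∀ i j, DifferentiableAt ℝ (fun p : Coord m × Coord m => G p.1 p.2 i j) (x t, v t))
    (hsymm : (G (x t) (v t)).IsSymm)
    (hx : HasDerivWithinAt x (v t) I t) (hv : HasDerivWithinAt v v' I t) :
    HasDerivWithinAt (fun s => (1 / 2 : ℝ) * (v s ⬝ᵥ (G (x s) (v s) *ᵥ v s)))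
      (v t ⬝ᵥ ((G (x t) (v t) + curvXi G (x t) (v t)) *ᵥ v' + curvForce G (x t) (v t))) I t := by
  have hG' : ∀ i j, DifferentiableAt ℝ (fun y => G y (v t) i j) (x t) := fun i j =>
    (hG i j).comp (f := fun y => (y, v t)) (x t) (hasFDerivAt_prodMk_left _ _).differentiableAt
  refine (hasDerivWithinAt_half_dotProduct_mulVec (hasDerivWithinAt_metric hG hx hv) hv
    hsymm).congr_deriv ?_
  rw [add_mulVec, add_mulVec, curvXi_mulVec, dotProduct_add, dotProduct_add, dotProduct_add,
    dotProduct_smul, dotProduct_curvForce hG', smul_eq_mul]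
  ring

variable {s : Set (Coord m × Coord m)}

theorem continuousOn_curvXi (hs : IsOpen s)
    (hG : ∀ i j, ContDiffOn ℝ 1 (fun p : Coord m × Coord m => G p.1 p.2 i j) s) :
    ContinuousOn (fun p : Coord m × Coord m => curvXi G p.1 p.2) s := by
  have hpartial : ∀ i j, ContinuousOn
      (fun p : Coord m × Coord m => fderiv ℝ (fun u => G p.1 u i j) p.2) s := fun i j =>
    continuousOn_fderiv_partial (g := fun (p : Coord m × Coord m) u => G p.1 u i j)
      (fun p hp => ((hG i j).contDiffAt (hs.mem_nhds hp)).comp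
        (f := fun z : (Coord m × Coord m) × Coord m => (z.1.1, z.2)) (p, p.2) (by fun_prop))
      contDiff_snd
  refine continuousOn_matrix fun j k => ?_
  simp only [curvXi, of_apply]
  fun_prop

theorem continuousOn_curvForce (hs : IsOpen s)
    (hG : ∀ i j, ContDiffOn ℝ 1 (fun p : Coord m × Coord m => G p.1 p.2 i j) s) :
    ContinuousOn (fun p : Coord m × Coord m => curvForce G p.1 p.2) s := by
  have hG' : ∀ i j, ∀ p ∈ s, ContDiffAt ℝ 1
      (fun z : (Coord m × Coord m) × Coord m => G z.2 z.1.2 i j) (p, p.1) := fun i j p hp =>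
    ((hG i j).contDiffAt (hs.mem_nhds hp)).comp
      (f := fun z : (Coord m × Coord m) × Coord m => (z.2, z.1.2)) (p, p.1) (by fun_prop)
  have hmetric : ∀ i j, ContinuousOn
      (fun p : Coord m × Coord m => fderiv ℝ (fun y => G y p.2 i j) p.1) s := fun i j =>
    continuousOn_fderiv_partial (g := fun (p : Coord m × Coord m) y => G y p.2 i j)
      (hG' i j) contDiff_fst
  have hquad : ∀ p ∈ s, ContDiffAt ℝ 1
      (fun z : (Coord m × Coord m) × Coord m => z.1.2 ⬝ᵥ (G z.2 z.1.2 *ᵥ z.1.2)) (p, p.1) := by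
    intro p hp
    simp only [dotProduct, mulVec]
    exact .sum fun i _ => .mul (by fun_prop) (.sum fun j _ => (hG' i j p hp).mul (by fun_prop))
  have hmetricDot : ContinuousOn (fun p : Coord m × Coord m => metricDot G p.1 p.2) s :=
    continuousOn_matrix fun i j => (hmetric i j).clm_apply continuousOn_snd
  have hgrad : ContinuousOn
      (fun p : Coord m × Coord m => grad (fun y => p.2 ⬝ᵥ (G y p.2 *ᵥ p.2)) p.1) s :=
    continuousOn_pi.2 fun k => (continuousOn_fderiv_partial
      (g := fun (p : Coord m × Coord m) y => p.2 ⬝ᵥ (G y p.2 *ᵥ p.2)) hquad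
      contDiff_fst).clm_apply continuousOn_const
  unfold curvForce
  fun_prop

end Metric

theorem dotProduct_sum_smul_pullback_mulVec {ι m R : Type*} [Fintype ι] [Fintype m] [CommRing R]
    {n : ι → Type*} [∀ i, Fintype (n i)] (c : ι → R) (J : ∀ i, Matrix (n i) m R)
    (A : ∀ i, Matrix (n i) (n i) R) (u v : m → R) :
    u ⬝ᵥ ((∑ i, c i • ((J i)ᵀ * A i * J i)) *ᵥ v)
      = ∑ i, c i * ((J i *ᵥ u) ⬝ᵥ (A i *ᵥ (J i *ᵥ v))) := by
  simp only [sum_mulVec, dotProduct_sum, smul_mulVec, dotProduct_smul, smul_eq_mul,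
    ← mulVec_mulVec, dotProduct_mulVec u, vecMul_transpose]

section Smoothness

variable {m n : ℕ} {U : Set (Coord m)} {ψ : Coord m → Coord n}

theorem continuousOn_comp_fst {X Y Z : Type*} [TopologicalSpace X] [TopologicalSpace Y]
    [TopologicalSpace Z] {φ : X → Z} {s : Set X} (hφ : ContinuousOn φ s) :
    ContinuousOn (fun p : X × Y => φ p.1) (s ×ˢ univ) :=
  hφ.comp continuousOn_fst fun _ hp => hp.1

theorem continuousOn_grad {φ : Coord m → ℝ} (hU : IsOpen U) (hφ : ContDiffOn ℝ 1 φ U) :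
    ContinuousOn (grad φ) U :=
  continuousOn_pi.2 fun _ =>
    (hφ.continuousOn_fderiv_of_isOpen hU le_rfl).clm_apply continuousOn_const

theorem contDiffOn_jac {k : WithTop ℕ∞} (hU : IsOpen U) (hψ : ContDiffOn ℝ (k + 1) ψ U)
    (i : Fin n) (j : Fin m) : ContDiffOn ℝ k (fun x => jac ψ x i j) U :=
  contDiffOn_pi.1 ((hψ.fderiv_of_isOpen hU le_rfl).clm_apply contDiffOn_const) i

theorem continuousOn_jac (hU : IsOpen U) (hψ : ContDiffOn ℝ 1 ψ U) : ContinuousOn (jac ψ) U :=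
  continuousOn_matrix fun i j =>
    (contDiffOn_jac (k := 0) hU (by rwa [zero_add]) i j).continuousOn

theorem continuousOn_jacDot (hU : IsOpen U) (hψ : ContDiffOn ℝ 2 ψ U) :
    ContinuousOn (fun p : Coord m × Coord m => jacDot ψ p.1 p.2) (U ×ˢ univ) :=
  continuousOn_matrix fun i j => (continuousOn_comp_fst <|
    (contDiffOn_jac hU (one_add_one_eq_two (R := WithTop ℕ∞) ▸ hψ) i
      j).continuousOn_fderiv_of_isOpen hU le_rfl).clm_apply continuousOn_snd

theorem continuousOn_comp_pushforward {Y : Type*} [TopologicalSpace Y]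
    {F : Coord n → Coord n → Y} {U' : Set (Coord n)} (hU : IsOpen U) (hψ : ContDiffOn ℝ 1 ψ U)
    (hmaps : MapsTo ψ U U') (hF : ContinuousOn (fun p => F p.1 p.2) (U' ×ˢ univ)) :
    ContinuousOn (fun p : Coord m × Coord m => F (ψ p.1) (jac ψ p.1 *ᵥ p.2)) (U ×ˢ univ) := by
  have hstate : ContinuousOn (fun p : Coord m × Coord m => (ψ p.1, jac ψ p.1 *ᵥ p.2))
      (U ×ˢ univ) :=
    (continuousOn_comp_fst hψ.continuousOn).prodMk
      (continuousOn_mulVec (continuousOn_comp_fst (continuousOn_jac hU hψ)) continuousOn_snd)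
  exact hF.comp hstate fun p hp => ⟨hmaps hp.1, mem_univ _⟩

theorem continuousOn_sum_smul_pullback {ι : Type*} [Fintype ι] {dim : ι → ℕ}
    {ψ : ∀ i, Coord m → Coord (dim i)} {w : ι → Coord m → ℝ} {U' : ∀ i, Set (Coord (dim i))}
    {A : ∀ i, Coord (dim i) → Coord (dim i) → Matrix (Fin (dim i)) (Fin (dim i)) ℝ}
    (hU : IsOpen U) (hψ : ∀ i, ContDiffOn ℝ 1 (ψ i) U) (hmaps : ∀ i, MapsTo (ψ i) U (U' i))
    (hw : ∀ i, ContinuousOn (w i) U)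
    (hA : ∀ i, ContinuousOn (fun p => A i p.1 p.2) (U' i ×ˢ univ)) :
    ContinuousOn (fun p : Coord m × Coord m => ∑ i, w i p.1 •
      ((jac (ψ i) p.1)ᵀ * A i (ψ i p.1) (jac (ψ i) p.1 *ᵥ p.2) * jac (ψ i) p.1))
      (U ×ˢ univ) := by
  refine continuousOn_finsetSum _ fun i _ => ?_
  have hJ : ContinuousOn (fun p : Coord m × Coord m => jac (ψ i) p.1) (U ×ˢ univ) :=
    continuousOn_comp_fst (continuousOn_jac hU (hψ i))
  have hJt : ContinuousOn (fun p : Coord m × Coord m => (jac (ψ i) p.1)ᵀ) (U ×ˢ univ) :=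
    continuous_id.matrix_transpose.comp_continuousOn hJ
  exact (continuousOn_comp_fst (hw i)).fun_smul (continuousOn_matrix_mul (continuousOn_matrix_mul
    hJt (continuousOn_comp_pushforward hU (hψ i) (hmaps i) (hA i))) hJ)

end Smoothness

namespace Leaf

variable {m : ℕ} {ℓ : Leaf m} {x : Coord m}

theorem IsGDS.differentiableAt_G (h : ℓ.IsGDS) (hx : x ∈ ℓ.dom) (v : Coord m) (i j : Fin m) :
    DifferentiableAt ℝ (fun p : Coord m × Coord m => ℓ.G p.1 p.2 i j) (x, v) :=
  ((h.contDiffOn_G i j).contDiffAt ((h.isOpen_dom.prod isOpen_univ).mem_nhds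
    ⟨hx, mem_univ v⟩)).differentiableAt one_ne_zero

theorem IsGDS.isSymm_G (h : ℓ.IsGDS) (hx : x ∈ ℓ.dom) (v : Coord m) : (ℓ.G x v).IsSymm :=
  (conjTranspose_eq_transpose_of_trivial _).symm.trans (h.posSemidef_G x hx v).isHermitian

theorem IsGDS.continuousOn_M (h : ℓ.IsGDS) :
    ContinuousOn (fun p : Coord m × Coord m => ℓ.M p.1 p.2) (ℓ.dom ×ˢ univ) :=
  (continuousOn_matrix fun i j => (h.contDiffOn_G i j).continuousOn).add
    (continuousOn_curvXi (h.isOpen_dom.prod isOpen_univ) h.contDiffOn_G)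

theorem IsGDS.M_mulVec_a (h : ℓ.IsGDS) (hx : x ∈ ℓ.dom) (v : Coord m) :
    ℓ.M x v *ᵥ ℓ.a x v = -grad ℓ.Φ x - ℓ.B x v *ᵥ v - curvForce ℓ.G x v :=
  eq_sub_of_add_eq (h.policy x hx v)

theorem IsGDS.continuousOn_M_mulVec_a (h : ℓ.IsGDS) :
    ContinuousOn (fun p : Coord m × Coord m => ℓ.M p.1 p.2 *ᵥ ℓ.a p.1 p.2) (ℓ.dom ×ˢ univ) := by
  have hgrad : ContinuousOn (fun p : Coord m × Coord m => grad ℓ.Φ p.1) (ℓ.dom ×ˢ univ) :=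
    continuousOn_comp_fst (continuousOn_grad h.isOpen_dom h.contDiffOn_Φ)
  have hB := continuousOn_matrix h.continuousOn_B
  have hcurv := continuousOn_curvForce (h.isOpen_dom.prod isOpen_univ) h.contDiffOn_G
  exact ContinuousOn.congr (by fun_prop) fun p hp => h.M_mulVec_a hp.1 p.2

end Leaf

namespace RMPTree

variable {m : ℕ} {T : RMPTree m}

theorem HasGDSLeaves.isOpen_dom (hT : T.HasGDSLeaves) : IsOpen T.dom := by
  cases T with
  | leaf ℓ => exact Leaf.IsGDS.isOpen_dom hT
  | node => exact hT.1

theorem HasGDSLeaves.continuousOn_M (hT : T.HasGDSLeaves) :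
    ContinuousOn (fun p : Coord m × Coord m => T.M p.1 p.2) (T.dom ×ˢ univ) := by
  induction T with
  | leaf ℓ => exact Leaf.IsGDS.continuousOn_M hT
  | node U K dim ψ w child ih =>
    obtain ⟨hU, hedge⟩ := hT
    choose hψ hmaps hw hchild using hedge
    exact continuousOn_sum_smul_pullback (A := fun i => (child i).M) hU
      (fun i => (hψ i).of_le one_le_two) hmaps (fun i => (hw i).continuousOn)
      fun i => ih i (hchild i)

theorem HasGDSLeaves.continuousOn_G (hT : T.HasGDSLeaves) :
    ContinuousOn (fun p : Coord m × Coord m => T.G p.1 p.2) (T.dom ×ˢ univ) := by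
  induction T with
  | leaf ℓ =>
    exact continuousOn_matrix fun i j => (Leaf.IsGDS.contDiffOn_G hT i j).continuousOn
  | node U K dim ψ w child ih =>
    obtain ⟨hU, hedge⟩ := hT
    choose hψ hmaps hw hchild using hedge
    exact continuousOn_sum_smul_pullback (A := fun i => (child i).G) hU
      (fun i => (hψ i).of_le one_le_two) hmaps (fun i => (hw i).continuousOn)
      fun i => ih i (hchild i)

theorem HasGDSLeaves.continuousOn_B (hT : T.HasGDSLeaves) :
    ContinuousOn (fun p : Coord m × Coord m => T.B p.1 p.2) (T.dom ×ˢ univ) := by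
  induction T with
  | leaf ℓ => exact continuousOn_matrix (Leaf.IsGDS.continuousOn_B hT)
  | node U K dim ψ w child ih =>
    obtain ⟨hU, hedge⟩ := hT
    choose hψ hmaps hw hchild using hedge
    exact continuousOn_sum_smul_pullback (A := fun i => (child i).B) hU
      (fun i => (hψ i).of_le one_le_two) hmaps (fun i => (hw i).continuousOn)
      fun i => ih i (hchild i)

theorem HasGDSLeaves.contDiffOn_Φ (hT : T.HasGDSLeaves) : ContDiffOn ℝ 1 T.Φ T.dom := by
  induction T with
  | leaf ℓ => exact Leaf.IsGDS.contDiffOn_Φ hT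
  | node U K dim ψ w child ih =>
    obtain ⟨-, hedge⟩ := hT
    choose hψ hmaps hw hchild using hedge
    exact .sum fun i _ =>
      (hw i).mul ((ih i (hchild i)).comp ((hψ i).of_le one_le_two) (hmaps i))

theorem V_eq (T : RMPTree m) (x v : Coord m) :
    T.V x v = (1 / 2 : ℝ) * (v ⬝ᵥ (T.G x v *ᵥ v)) + T.Φ x := by
  induction T with
  | leaf ℓ => rfl
  | node U K dim ψ w child ih =>
    simp only [V, G, Φ, ih, dotProduct_sum_smul_pullback_mulVec, Finset.mul_sum,
      ← Finset.sum_add_distrib]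
    exact Finset.sum_congr rfl fun i _ => by ring

theorem L_eq (T : RMPTree m) (x v : Coord m) :
    T.L x v = (1 / 2 : ℝ) * (v ⬝ᵥ (T.G x v *ᵥ v)) - T.Φ x := by
  induction T with
  | leaf ℓ => rfl
  | node U K dim ψ w child ih =>
    simp only [L, G, Φ, ih, dotProduct_sum_smul_pullback_mulVec, Finset.mul_sum,
      ← Finset.sum_sub_distrib]
    exact Finset.sum_congr rfl fun i _ => by ring

theorem HasGDSLeaves.continuousOn_V (hT : T.HasGDSLeaves) :
    ContinuousOn (fun p : Coord m × Coord m => T.V p.1 p.2) (T.dom ×ˢ univ) := by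
  have hG := hT.continuousOn_G
  have hΦ := continuousOn_comp_fst (Y := Coord m) hT.contDiffOn_Φ.continuousOn
  simp only [V_eq]
  exact .add (by fun_prop) hΦ

theorem HasGDSLeaves.continuousOn_L (hT : T.HasGDSLeaves) :
    ContinuousOn (fun p : Coord m × Coord m => T.L p.1 p.2) (T.dom ×ˢ univ) := by
  have hG := hT.continuousOn_G
  have hΦ := continuousOn_comp_fst (Y := Coord m) hT.contDiffOn_Φ.continuousOn
  simp only [L_eq]
  exact .sub (by fun_prop) hΦ

theorem HasGDSLeaves.continuousOn_f (hT : T.HasGDSLeaves) :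
    ContinuousOn (fun p : Coord m × Coord m => T.f p.1 p.2) (T.dom ×ˢ univ) := by
  induction T with
  | leaf ℓ => exact Leaf.IsGDS.continuousOn_M_mulVec_a hT
  | @node m U K dim ψ w child ih =>
    obtain ⟨hU, hedge⟩ := hT
    refine continuousOn_finsetSum _ fun i _ => ?_
    obtain ⟨hψ, hmaps, hw, hchild⟩ := hedge i
    have hψ₁ : ContDiffOn ℝ 1 (ψ i) U := hψ.of_le one_le_two
    have hJ : ContinuousOn (fun p : Coord m × Coord m => jac (ψ i) p.1) (U ×ˢ univ) :=
      continuousOn_comp_fst (continuousOn_jac hU hψ₁)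
    have hJt : ContinuousOn (fun p : Coord m × Coord m => (jac (ψ i) p.1)ᵀ) (U ×ˢ univ) :=
      continuous_id.matrix_transpose.comp_continuousOn hJ
    have hdJ := continuousOn_jacDot hU hψ
    have hw₀ : ContinuousOn (fun p : Coord m × Coord m => w i p.1) (U ×ˢ univ) :=
      continuousOn_comp_fst hw.continuousOn
    have hdw : ContinuousOn (fun p : Coord m × Coord m => grad (w i) p.1) (U ×ˢ univ) :=
      continuousOn_comp_fst (continuousOn_grad hU hw)
    have hf := continuousOn_comp_pushforward hU hψ₁ hmaps (ih i hchild)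
    have hM := continuousOn_comp_pushforward hU hψ₁ hmaps hchild.continuousOn_M
    have hG := continuousOn_comp_pushforward hU hψ₁ hmaps hchild.continuousOn_G
    have hL := continuousOn_comp_pushforward hU hψ₁ hmaps hchild.continuousOn_L
    exact (hw₀.fun_smul (continuousOn_mulVec hJt
        (hf.fun_sub (continuousOn_mulVec hM (continuousOn_mulVec hdJ continuousOn_snd))))).fun_add
      ((hL.fun_smul hdw).fun_sub ((continuousOn_dotProduct continuousOn_snd hdw).fun_smul
        (continuousOn_mulVec (continuousOn_matrix_mul (continuousOn_matrix_mul hJt hG) hJ)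
          continuousOn_snd)))

theorem HasGDSLeaves.f_zero (hT : T.HasGDSLeaves) {x : Coord m} (hx : x ∈ T.dom) :
    T.f x 0 = -grad T.Φ x := by
  induction T with
  | leaf ℓ =>
    refine (Leaf.IsGDS.M_mulVec_a hT hx 0).trans ?_
    rw [curvForce_zero, mulVec_zero, sub_zero, sub_zero]
    rfl
  | @node m U K dim ψ w child ih =>
    obtain ⟨hU, hedge⟩ := hT
    choose hψ hmaps hw hchild using hedge
    have hUx : U ∈ 𝓝 x := hU.mem_nhds hx
    have hgrad := grad_sum_mul_comp (φ := fun i => (child i).Φ)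
      (fun i => ((hw i).contDiffAt hUx).differentiableAt one_ne_zero)
      (fun i => ((hψ i).contDiffAt hUx).differentiableAt two_ne_zero)
      fun i => ((hchild i).contDiffOn_Φ.contDiffAt
        ((hchild i).isOpen_dom.mem_nhds (hmaps i hx))).differentiableAt one_ne_zero
    have hL : ∀ i, (child i).L (ψ i x) 0 = -(child i).Φ (ψ i x) := fun i => by
      rw [L_eq, zero_dotProduct, mul_zero, zero_sub]
    have hf : ∀ i, (child i).f (ψ i x) 0 = -grad (child i).Φ (ψ i x) := fun i =>
      ih i (hchild i) (hmaps i hx)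
    refine Eq.trans ?_ (congrArg Neg.neg hgrad.symm)
    simp only [f, mulVec_zero, zero_dotProduct, zero_smul, sub_zero, hL, hf, mulVec_neg, smul_neg,
      neg_smul, ← Finset.sum_neg_distrib, neg_add]

theorem dotProduct_f_node (U : Set (Coord m)) {K : ℕ} {dim : Fin K → ℕ}
    (ψ : ∀ i, Coord m → Coord (dim i)) (w : Fin K → Coord m → ℝ) (child : ∀ i, RMPTree (dim i))
    (x v : Coord m) :
    v ⬝ᵥ (node U K dim ψ w child).f x v
      = ∑ i, (w i x * ((jac (ψ i) x *ᵥ v) ⬝ᵥ ((child i).f (ψ i x) (jac (ψ i) x *ᵥ v)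
          - (child i).M (ψ i x) (jac (ψ i) x *ᵥ v) *ᵥ (jacDot (ψ i) x v *ᵥ v)))
        - v ⬝ᵥ grad (w i) x * (child i).V (ψ i x) (jac (ψ i) x *ᵥ v)) := by
  rw [f, dotProduct_sum]
  refine Finset.sum_congr rfl fun i _ => ?_
  rw [dotProduct_add, dotProduct_sub, dotProduct_smul, dotProduct_smul, dotProduct_smul,
    dotProduct_mulVec v, vecMul_transpose, ← mulVec_mulVec, ← mulVec_mulVec,
    dotProduct_mulVec v (jac (ψ i) x)ᵀ, vecMul_transpose, L_eq, V_eq, smul_eq_mul, smul_eq_mul,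
    smul_eq_mul]
  ring

theorem HasGDSLeaves.hasDerivWithinAt_V (hT : T.HasGDSLeaves) {I : Set ℝ} {t : ℝ}
    {x v : ℝ → Coord m} {a : Coord m} (ht : x t ∈ T.dom) (hx : HasDerivWithinAt x (v t) I t)
    (hv : HasDerivWithinAt v a I t) :
    HasDerivWithinAt (fun s => T.V (x s) (v s))
      (v t ⬝ᵥ (T.M (x t) (v t) *ᵥ a - T.f (x t) (v t)) - v t ⬝ᵥ (T.B (x t) (v t) *ᵥ v t)) I t := by
  induction T with
  | leaf ℓ =>
    have hℓ : ℓ.IsGDS := hT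
    have hΦ : DifferentiableAt ℝ ℓ.Φ (x t) :=
      (hℓ.contDiffOn_Φ.contDiffAt (hℓ.isOpen_dom.mem_nhds ht)).differentiableAt one_ne_zero
    have hkinetic : HasDerivWithinAt (fun s => (1 / 2 : ℝ) * (v s ⬝ᵥ (ℓ.G (x s) (v s) *ᵥ v s)))
        (v t ⬝ᵥ (ℓ.M (x t) (v t) *ᵥ a + curvForce ℓ.G (x t) (v t))) I t :=
      hasDerivWithinAt_kinetic (hℓ.differentiableAt_G ht _) (hℓ.isSymm_G ht _) hx hv
    refine (hkinetic.fun_add (hasDerivWithinAt_comp_grad hΦ hx)).congr_deriv ?_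
    simp only [M, f, B, hℓ.M_mulVec_a ht, dotProduct_add, dotProduct_sub, dotProduct_neg]
    ring
  | node U K dim ψ w child ih =>
    obtain ⟨hU, hedge⟩ := hT
    choose hψ hmaps hw hchild using hedge
    have hUx : U ∈ 𝓝 (x t) := hU.mem_nhds ht
    have hV : ∀ i, HasDerivWithinAt (fun s => (child i).V (ψ i (x s)) (jac (ψ i) (x s) *ᵥ v s))
        _ I t := fun i =>
      ih i (hchild i) (hmaps i ht)
        (hasDerivWithinAt_comp_jac (((hψ i).contDiffAt hUx).differentiableAt two_ne_zero) hx)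
        (hasDerivWithinAt_jac_mulVec (fun j k => ((contDiffOn_jac hU (one_add_one_eq_two
          (R := WithTop ℕ∞) ▸ hψ i) j k).contDiffAt hUx).differentiableAt one_ne_zero) hx hv)
    have hwx : ∀ i, HasDerivWithinAt (fun s => w i (x s)) (v t ⬝ᵥ grad (w i) (x t)) I t := fun i =>
      hasDerivWithinAt_comp_grad (((hw i).contDiffAt hUx).differentiableAt one_ne_zero) hx
    refine (HasDerivWithinAt.fun_sum fun i _ => (hwx i).fun_mul (hV i)).congr_deriv ?_
    rw [dotProduct_sub, dotProduct_f_node, M, B, dotProduct_sum_smul_pullback_mulVec,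
      dotProduct_sum_smul_pullback_mulVec, ← Finset.sum_sub_distrib, ← Finset.sum_sub_distrib]
    refine Finset.sum_congr rfl fun i _ => ?_
    simp only [mulVec_add, dotProduct_sub, dotProduct_add]
    ring

theorem WeightsNonneg.dotProduct_B_nonneg (hw : T.WeightsNonneg) (hT : T.HasGDSLeaves)
    {x : Coord m} (hx : x ∈ T.dom) (v : Coord m) : 0 ≤ v ⬝ᵥ (T.B x v *ᵥ v) := by
  induction T with
  | leaf ℓ => exact (Leaf.IsGDS.posSemidef_B hT x hx v).dotProduct_mulVec_nonneg v
  | node U K dim ψ w child ih =>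
    rw [B, dotProduct_sum_smul_pullback_mulVec]
    exact Finset.sum_nonneg fun i _ => mul_nonneg ((hw i).1 x hx)
      (ih i (hw i).2 (hT.2 i).2.2.2 ((hT.2 i).2.1 hx) _)

end RMPTree

section MoorePenrose

variable {m : ℕ} {A : Matrix (Fin m) (Fin m) ℝ}

theorem IsPosDef.isUnit (hA : IsPosDef A) : IsUnit A := by
  rw [isUnit_iff_isUnit_det, isUnit_iff_ne_zero]
  intro hdet
  obtain ⟨u, hu, hAu⟩ := exists_mulVec_eq_zero_iff.2 hdet
  have hpos : 0 < u ⬝ᵥ (A *ᵥ u) := hA u hu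
  rw [hAu, dotProduct_zero] at hpos
  exact hpos.false

theorem pinv_eq_inv (hA : IsUnit A) : pinv A = A⁻¹ := by
  have hdet := (isUnit_iff_isUnit_det A).1 hA
  have hinv : IsMoorePenrose A A⁻¹ := by
    constructor <;> simp [mul_nonsing_inv A hdet, nonsing_inv_mul A hdet]
  have hpinv : A * pinv A * A = A :=
    (Classical.epsilon_spec (p := IsMoorePenrose A) ⟨A⁻¹, hinv⟩).mul_mul_left
  have hone : A * pinv A = 1 := hA.mul_right_cancel (hpinv.trans (one_mul A).symm)
  exact (inv_eq_right_inv hone).symm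

end MoorePenrose

section Lyapunov

variable {E F : Type*} [NormedAddCommGroup E] [NormedSpace ℝ E] [NormedAddCommGroup F] {a : ℝ}

theorem norm_image_sub_sub_smul_le_of_hasDerivWithinAt {g g' : ℝ → E} {c : E} {r s K : ℝ}
    (hrs : r ≤ s) (hg : ∀ t ∈ Icc r s, HasDerivWithinAt g (g' t) (Icc r s) t)
    (hg' : ∀ t ∈ Icc r s, ‖g' t - c‖ ≤ K) : ‖g s - g r - (s - r) • c‖ ≤ K * (s - r) := by
  have hderiv : ∀ t ∈ Icc r s, HasDerivWithinAt (fun t => g t - t • c) (g' t - c) (Icc r s) t :=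
    fun t ht => by
      simpa only [one_smul, id_eq] using
        (hg t ht).fun_sub ((hasDerivWithinAt_id t _).smul_const c)
  have hmean := (convex_Icc r s).norm_image_sub_le_of_norm_hasDerivWithin_le hderiv hg'
    (left_mem_Icc.2 hrs) (right_mem_Icc.2 hrs)
  rw [Real.norm_of_nonneg (sub_nonneg.2 hrs)] at hmean
  convert hmean using 2
  module

theorem tendsto_deriv_zero_of_uniformContinuousOn {g g' : ℝ → E} {c : E}
    (hg : ∀ t ∈ Ici a, HasDerivWithinAt g (g' t) (Ici a) t) (hc : Tendsto g atTop (𝓝 c))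
    (hg' : UniformContinuousOn g' (Ici a)) : Tendsto g' atTop (𝓝 0) := by
  rw [Metric.tendsto_nhds]
  intro ε hε
  obtain ⟨δ, hδ, hclose⟩ := Metric.uniformContinuousOn_iff_le.1 hg' (ε / 2) (half_pos hε)
  have hincrement : Tendsto (fun t => g (t + δ) - g t) atTop (𝓝 0) :=
    sub_self c ▸ (hc.comp (tendsto_atTop_add_const_right _ δ tendsto_id)).sub hc
  filter_upwards [Metric.tendsto_nhds.1 hincrement _ (mul_pos (half_pos hε) hδ),
    eventually_ge_atTop a] with t ht hat
  rw [dist_zero_right] at ht ⊢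
  have hIcc : Icc t (t + δ) ⊆ Ici a := fun s hs => hat.trans hs.1
  have hvar : ∀ s ∈ Icc t (t + δ), ‖g' s - g' t‖ ≤ ε / 2 := fun s hs => by
    rw [← dist_eq_norm]
    refine hclose s (hIcc hs) t hat ?_
    rw [Real.dist_eq, abs_of_nonneg (sub_nonneg.2 hs.1)]
    exact sub_le_iff_le_add'.2 hs.2
  have htaylor := norm_image_sub_sub_smul_le_of_hasDerivWithinAt (le_add_of_nonneg_right hδ.le)
    (fun s hs => (hg s (hIcc hs)).mono hIcc) hvar
  rw [add_sub_cancel_left] at htaylor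
  have hscaled : δ * ‖g' t‖ < δ * ε :=
    calc δ * ‖g' t‖ = ‖δ • g' t‖ := by rw [norm_smul, Real.norm_of_nonneg hδ.le]
      _ ≤ ‖g (t + δ) - g t‖ + ‖g (t + δ) - g t - δ • g' t‖ := norm_le_norm_add_norm_sub _ _
      _ < δ * ε := by linarith
  exact lt_of_mul_lt_mul_left hscaled hδ.le

theorem exists_tendsto_of_hasDerivWithinAt_nonpos {g g' : ℝ → ℝ}
    (hg : ∀ t ∈ Ici a, HasDerivWithinAt g (g' t) (Ici a) t) (hg' : ∀ t ∈ Ici a, g' t ≤ 0)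
    (hbdd : BddBelow (g '' Ici a)) : ∃ c, Tendsto g atTop (𝓝 c) := by
  have hanti : AntitoneOn g (Ici a) :=
    antitoneOn_of_hasDerivWithinAt_nonpos (convex_Ici a)
      (fun t ht => (hg t ht).continuousWithinAt)
      (fun t ht => (hg t (interior_subset ht)).mono interior_subset)
      (fun t ht => hg' t (interior_subset ht))
  have hmem : ∀ t, max t a ∈ Ici a := fun t => le_max_right t a
  have hmax : Antitone fun t => g (max t a) := fun s t hst =>
    hanti (hmem s) (hmem t) (max_le_max_right a hst)
  have hmax_bdd : BddBelow (range fun t => g (max t a)) :=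
    hbdd.mono (range_subset_iff.2 fun t => mem_image_of_mem g (hmem t))
  refine ⟨_, (tendsto_atTop_ciInf hmax hmax_bdd).congr' ?_⟩
  filter_upwards [eventually_ge_atTop a] with t ht
  rw [max_eq_left ht]

theorem tendsto_nhdsSet_of_isCompact {X Y ι : Type*} [TopologicalSpace X] [TopologicalSpace Y]
    [T2Space Y] {l : Filter ι} {z : ι → X} {H : X → Y} {C : Set X} {y : Y} (hC : IsCompact C)
    (hH : ContinuousOn H C) (hz : ∀ᶠ t in l, z t ∈ C) (hlim : Tendsto (fun t => H (z t)) l (𝓝 y)) :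
    Tendsto z l (𝓝ˢ {p ∈ C | H p = y}) := by
  refine hC.tendsto_nhdsSet_of_mapClusterPt hz fun p hp hcluster => ⟨hp, ?_⟩
  have : NeBot (𝓝 p ⊓ map z l) := hcluster
  have hle : 𝓝 p ⊓ map z l ≤ 𝓝[C] p :=
    le_inf inf_le_left (inf_le_right.trans (le_principal_iff.2 hz))
  exact tendsto_nhds_unique ((hH p hp).mono_left hle) ((tendsto_map'_iff.2 hlim).mono_left
    inf_le_right)

variable {z : ℝ → E} {Y : E → E} {C : Set E}

theorem uniformContinuousOn_comp_of_isIntegralCurveOn {H : E → F} (hC : IsCompact C)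
    (hY : ContinuousOn Y C) (hz : IsIntegralCurveOn z (fun _ => Y) (Ici a))
    (hzC : MapsTo z (Ici a) C) (hH : ContinuousOn H C) :
    UniformContinuousOn (fun t => H (z t)) (Ici a) := by
  obtain ⟨K, hK⟩ := hC.exists_bound_of_continuousOn hY
  have hlip : LipschitzOnWith K.toNNReal z (Ici a) :=
    (convex_Ici a).lipschitzOnWith_of_nnnorm_hasDerivWithin_le hz fun t ht =>
      NNReal.coe_le_coe.1 ((hK _ (hzC ht)).trans (Real.le_coe_toNNReal K))
  exact (hC.uniformContinuousOn_of_continuous hH).comp hlip.uniformContinuousOn hzC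

theorem tendsto_lyapunovDeriv_zero {V D : E → ℝ} (hC : IsCompact C) (hY : ContinuousOn Y C)
    (hz : IsIntegralCurveOn z (fun _ => Y) (Ici a)) (hzC : MapsTo z (Ici a) C)
    (hV : ContinuousOn V C) (hD : ContinuousOn D C)
    (hVD : ∀ t ∈ Ici a, HasDerivWithinAt (fun s => V (z s)) (D (z t)) (Ici a) t)
    (hD_nonpos : ∀ p ∈ C, D p ≤ 0) : Tendsto (fun t => D (z t)) atTop (𝓝 0) := by
  have hbdd : BddBelow ((fun s => V (z s)) '' Ici a) := by
    refine (hC.bddBelow_image hV).mono ?_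
    rintro _ ⟨t, ht, rfl⟩
    exact mem_image_of_mem V (hzC ht)
  obtain ⟨c, hc⟩ :=
    exists_tendsto_of_hasDerivWithinAt_nonpos hVD (fun t ht => hD_nonpos _ (hzC ht)) hbdd
  exact tendsto_deriv_zero_of_uniformContinuousOn hVD hc
    (uniformContinuousOn_comp_of_isIntegralCurveOn hC hY hz hzC hD)

end Lyapunov

namespace RMPTree

variable {m : ℕ} {T : RMPTree m}

/-- The global policy as a first-order vector field `(ẋ, ẍ)` on the states `(x, ẋ)`. -/
noncomputable def vectorField (T : RMPTree m) (p : Coord m × Coord m) : Coord m × Coord m :=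
  (p.2, T.policy p.1 p.2)

theorem mulVec_policy {x v : Coord m} (hM : IsUnit (T.M x v)) :
    T.M x v *ᵥ T.policy x v = T.f x v := by
  rw [policy, pinv_eq_inv hM, mulVec_mulVec,
    mul_nonsing_inv _ ((isUnit_iff_isUnit_det _).1 hM), one_mulVec]

theorem HasGDSLeaves.continuousOn_policy (hT : T.HasGDSLeaves)
    (hM : ∀ x ∈ T.dom, ∀ v, IsUnit (T.M x v)) :
    ContinuousOn (fun p : Coord m × Coord m => T.policy p.1 p.2) (T.dom ×ˢ univ) := by
  have hinv : ContinuousOn (fun p : Coord m × Coord m => (T.M p.1 p.2)⁻¹) (T.dom ×ˢ univ) :=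
    fun p hp =>
    have hdet := (isUnit_iff_isUnit_det _).1 (hM p.1 hp.1 p.2)
    (continuousAt_matrix_inv _ (NormedRing.inverse_continuousAt hdet.unit)).comp_continuousWithinAt
      (f := fun p : Coord m × Coord m => T.M p.1 p.2) (hT.continuousOn_M p hp)
  exact (continuousOn_mulVec hinv hT.continuousOn_f).congr fun p hp => by
    rw [policy, pinv_eq_inv (hM p.1 hp.1 p.2)]

theorem HasGDSLeaves.continuousOn_vectorField (hT : T.HasGDSLeaves)
    (hM : ∀ x ∈ T.dom, ∀ v, IsUnit (T.M x v)) :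
    ContinuousOn T.vectorField (T.dom ×ˢ univ) :=
  continuousOn_snd.prodMk (hT.continuousOn_policy hM)

theorem HasGDSLeaves.grad_Φ_eq_zero (hT : T.HasGDSLeaves) {x : Coord m} (hx : x ∈ T.dom)
    (hM : IsUnit (T.M x 0)) (hrest : T.policy x 0 = 0) : grad T.Φ x = 0 := by
  rw [← neg_eq_zero, ← hT.f_zero hx, ← mulVec_policy hM, hrest, mulVec_zero]

section Trajectory

variable {q qd : ℝ → Coord m} {I : Set ℝ}

theorem IsTrajectoryOn.isIntegralCurveOn (h : T.IsTrajectoryOn q qd I) :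
    IsIntegralCurveOn (fun t => (q t, qd t)) (fun _ => T.vectorField) I :=
  fun t ht => (h.hasDeriv_q t ht).prodMk (h.hasDeriv_qd t ht)

theorem IsTrajectoryOn.hasDerivWithinAt_V (h : T.IsTrajectoryOn q qd I) (hT : T.HasGDSLeaves)
    {t : ℝ} (ht : t ∈ I) (hM : IsUnit (T.M (q t) (qd t))) :
    HasDerivWithinAt (fun s => T.V (q s) (qd s))
      (-(qd t ⬝ᵥ (T.B (q t) (qd t) *ᵥ qd t))) I t := by
  refine (hT.hasDerivWithinAt_V (h.mem_dom t ht) (h.hasDeriv_q t ht)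
    (h.hasDeriv_qd t ht)).congr_deriv ?_
  rw [mulVec_policy hM, sub_self, dotProduct_zero, zero_sub]

variable {a : ℝ} {C : Set (Coord m × Coord m)}

theorem IsTrajectoryOn.tendsto_velocity (h : T.IsTrajectoryOn q qd (Ici a)) (hT : T.HasGDSLeaves)
    (hM : ∀ x ∈ T.dom, ∀ v, IsUnit (T.M x v))
    (hB : ∀ x ∈ T.dom, ∀ v, v ≠ 0 → 0 < v ⬝ᵥ (T.B x v *ᵥ v)) (hC : IsCompact C)
    (hCdom : C ⊆ T.dom ×ˢ univ) (hzC : ∀ t ∈ Ici a, (q t, qd t) ∈ C) :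
    Tendsto qd atTop (𝓝 0) := by
  set D : Coord m × Coord m → ℝ := fun p => -(p.2 ⬝ᵥ (T.B p.1 p.2 *ᵥ p.2)) with hD_def
  have hD : ContinuousOn D C := by
    have hB' := hT.continuousOn_B.mono hCdom
    fun_prop
  have hD_neg : ∀ p ∈ C, p.2 ≠ 0 → D p < 0 := fun p hp hv =>
    neg_lt_zero.2 (hB p.1 (hCdom hp).1 p.2 hv)
  have hD_nonpos : ∀ p ∈ C, D p ≤ 0 := fun p hp => by
    rcases eq_or_ne p.2 0 with hv | hv
    · simp only [hD_def, hv, zero_dotProduct, neg_zero, le_rfl]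
    · exact (hD_neg p hp hv).le
  have hpower : Tendsto (fun t => D (q t, qd t)) atTop (𝓝 0) :=
    tendsto_lyapunovDeriv_zero hC ((hT.continuousOn_vectorField hM).mono hCdom)
      h.isIntegralCurveOn hzC (hT.continuousOn_V.mono hCdom) hD
      (fun t ht => h.hasDerivWithinAt_V hT ht (hM _ (h.mem_dom t ht) _)) hD_nonpos
  have hstate := tendsto_nhdsSet_of_isCompact hC hD ((eventually_ge_atTop a).mono hzC) hpower
  rw [← nhdsSet_singleton]
  exact (continuous_snd.tendsto_nhdsSet fun p hp =>
    by_contra fun hv => (hD_neg p hp.1 hv).ne hp.2).comp hstate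

theorem IsTrajectoryOn.tendsto_policy (h : T.IsTrajectoryOn q qd (Ici a)) (hT : T.HasGDSLeaves)
    (hM : ∀ x ∈ T.dom, ∀ v, IsUnit (T.M x v)) (hC : IsCompact C) (hCdom : C ⊆ T.dom ×ˢ univ)
    (hzC : ∀ t ∈ Ici a, (q t, qd t) ∈ C) {c : Coord m} (hqd : Tendsto qd atTop (𝓝 c)) :
    Tendsto (fun t => T.policy (q t) (qd t)) atTop (𝓝 0) :=
  tendsto_deriv_zero_of_uniformContinuousOn h.hasDeriv_qd hqd
    (uniformContinuousOn_comp_of_isIntegralCurveOn hC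
      ((hT.continuousOn_vectorField hM).mono hCdom) h.isIntegralCurveOn hzC
      ((hT.continuousOn_policy hM).mono hCdom))

theorem IsTrajectoryOn.tendsto_nhdsSet (h : T.IsTrajectoryOn q qd (Ici a)) (hT : T.HasGDSLeaves)
    (hM : ∀ x ∈ T.dom, ∀ v, IsUnit (T.M x v))
    (hB : ∀ x ∈ T.dom, ∀ v, v ≠ 0 → 0 < v ⬝ᵥ (T.B x v *ᵥ v)) (hC : IsCompact C)
    (hCdom : C ⊆ T.dom ×ˢ univ) (hzC : ∀ t ∈ Ici a, (q t, qd t) ∈ C) :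
    Tendsto (fun t => (q t, qd t)) atTop
      (𝓝ˢ {p : Coord m × Coord m | p.1 ∈ T.dom ∧ grad T.Φ p.1 = 0 ∧ p.2 = 0}) := by
  have hvelocity := h.tendsto_velocity hT hM hB hC hCdom hzC
  have hpolicy := h.tendsto_policy hT hM hC hCdom hzC hvelocity
  have hstate := tendsto_nhdsSet_of_isCompact hC ((hT.continuousOn_vectorField hM).mono hCdom)
    ((eventually_ge_atTop a).mono hzC) (hvelocity.prodMk_nhds hpolicy)
  refine hstate.mono_right (nhdsSet_mono ?_)
  rintro ⟨x, v⟩ ⟨hp, hzero⟩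
  obtain ⟨rfl, hrest⟩ : v = 0 ∧ T.policy x v = 0 := Prod.mk.inj hzero
  have hx : x ∈ T.dom := (hCdom hp).1
  exact ⟨hx, hT.grad_Φ_eq_zero hx (hM x hx 0) hrest, rfl⟩

end Trajectory

end RMPTree

theorem theorem2_general {d : ℕ} (T : RMPTree d) (hT : T.HasGDSLeaves)
    (hM : ∀ x ∈ T.dom, ∀ v, IsUnit (T.M x v)) :
    (∀ (I : Set ℝ) (q qd : ℝ → Coord d), T.IsTrajectoryOn q qd I →
      (∀ t ∈ I, HasDerivWithinAt (fun s => T.V (q s) (qd s))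
        (-(qd t ⬝ᵥ (T.B (q t) (qd t) *ᵥ qd t))) I t) ∧
      (T.WeightsNonneg → ∀ t ∈ I, -(qd t ⬝ᵥ (T.B (q t) (qd t) *ᵥ qd t)) ≤ 0)) ∧
    ((∀ x ∈ T.dom, ∀ v, v ≠ 0 → 0 < v ⬝ᵥ (T.B x v *ᵥ v)) →
      ∀ q qd : ℝ → Coord d, T.IsTrajectoryOn q qd (Ici 0) →
      ∀ C : Set (Coord d × Coord d), IsCompact C → C ⊆ T.dom ×ˢ univ →
        (∀ t ∈ Ici (0 : ℝ), (q t, qd t) ∈ C) →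
        Tendsto (fun t => (q t, qd t)) atTop
          (𝓝ˢ {p : Coord d × Coord d | p.1 ∈ T.dom ∧ grad T.Φ p.1 = 0 ∧ p.2 = 0})) := by
  refine ⟨fun I q qd h => ⟨?_, ?_⟩, ?_⟩
  · exact fun t ht => h.hasDerivWithinAt_V hT ht (hM _ (h.mem_dom t ht) _)
  · exact fun hw t ht => neg_nonpos.2 (hw.dotProduct_B_nonneg hT (h.mem_dom t ht) _)
  · exact fun hB q qd h C hC hCdom hzC => h.tendsto_nhdsSet hT hM hB hC hCdom hzC

theorem theorem2 {d : ℕ} (T : RMPTree d) (hT : T.HasGDSLeaves)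
    (hM : ∀ x ∈ T.dom, ∀ v, IsPosDef (T.M x v)) :
    (∀ (I : Set ℝ) (q qd : ℝ → Coord d), T.IsTrajectoryOn q qd I →
      (∀ t ∈ I, HasDerivWithinAt (fun s => T.V (q s) (qd s))
        (-(qd t ⬝ᵥ (T.B (q t) (qd t) *ᵥ qd t))) I t) ∧
      (T.WeightsNonneg → ∀ t ∈ I, -(qd t ⬝ᵥ (T.B (q t) (qd t) *ᵥ qd t)) ≤ 0)) ∧
    ((∀ x ∈ T.dom, ∀ v, IsPosDef (T.G x v)) → (∀ x ∈ T.dom, ∀ v, IsPosDef (T.B x v)) →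
      ∀ q qd : ℝ → Coord d, T.IsTrajectoryOn q qd (Ici 0) →
      ∀ C : Set (Coord d × Coord d), IsCompact C → C ⊆ T.dom ×ˢ univ →
        (∀ t ∈ Ici (0 : ℝ), (q t, qd t) ∈ C) →
        Tendsto (fun t => (q t, qd t)) atTop
          (𝓝ˢ {p : Coord d × Coord d | p.1 ∈ T.dom ∧ grad T.Φ p.1 = 0 ∧ p.2 = 0})) := by
  have h := theorem2_general T hT fun x hx v => (hM x hx v).isUnit
  exact ⟨h.1, fun _ hB => h.2 fun x hx v => hB x hx v v⟩
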